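/- Let $H$ be a complex Hilbert space, let $\mathcal B$ be a $C^*$-algebra of operators on $H$ (a norm-closed $*$-subalgebra of $\mathcal B(H)$, not assumed unital), and let $K$ be its state space, i.e. the set of positive linear functionals of norm one on $\mathcal B$ with the weak* topology. Let $x\in H$ be a unit vector, and let $\mu$ be a positive regular Borel measure on $K$ with $0<\mu(K)\le 1$ (for example a probability measure) whose barycenter $\mu(K)^{-1}\int_K\omega\,d\mu(\omega)$, the integral being taken pointwise on $\mathcal B$, is the restriction to $\mathcal B$ of $\omega_x(A)=\langle x,Ax\rangle$. Suppose that the commutant $\mathcal B'$ is hyperfinite, i.e. $\mathcal B'$ is the weak-operator closure of the union of an upward directed family of finite-dimensional $C^*$-algebras of operators on $H$. Then there is a completely positive instrument $\mathcal E$ on $\mathcal B(H)$, that is, a family of completely positive linear maps $\mathcal E[S]:\mathcal B(H)\to\mathcal B(H)$, indexed by the Borel sets $S\subseteq K$, such that $\mathcal E[S](I)\le I$ for every $S$ and $S\mapsto\mathcal E[S](T)$ is $\sigma$-additive in the weak-operator topology for every $T\in\mathcal B(H)$, with the following two properties. It is local to $\mathcal B'$: $\mathcal E[S](T)=\mathcal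 E[S](I)\,T$ for all Borel $S\subseteq K$ and all $T\in\mathcal B''$. And \[ \langle x,\mathcal E[S](B)x\rangle=\int_S\omega(B)\,d\mu(\omega) \] for all Borel $S\subseteq K$ and all $B\in\mathcal B$. -/

import Mathlib

open MeasureTheory
open scoped InnerProductSpace ComplexOrder CStarAlgebra

noncomputable section

namespace HJW

variable {H : Type*} [NormedAddCommGroup H] [InnerProductSpace ℂ H] [CompleteSpace H]

/-- The commutant `𝓑'` of a `*`-algebra `𝓑` of bounded operators on `H`, as a von Neumann algebra:
the operators that commute with every element of `𝓑`. -/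
def commutant (𝓑 : NonUnitalStarSubalgebra ℂ (H →L[ℂ] H)) : VonNeumannAlgebra H where
  toStarSubalgebra := StarSubalgebra.centralizer ℂ (𝓑 : Set (H →L[ℂ] H))
  centralizer_centralizer' := by simp

theorem mem_commutant_iff {𝓑 : NonUnitalStarSubalgebra ℂ (H →L[ℂ] H)} {T : H →L[ℂ] H} :
    T ∈ commutant 𝓑 ↔ ∀ B ∈ 𝓑, B * T = T * B := by
  refine (StarSubalgebra.mem_centralizer_iff ℂ).trans ?_
  exact ⟨fun h B hB => (h B hB).1, fun h B hB => ⟨h B hB, h _ (star_mem hB)⟩⟩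

/-- A von Neumann algebra is hyperfinite if it is the weak-operator closure of the union of an
upward directed family of finite-dimensional `C*`-algebras. -/
def IsHyperfinite (R : VonNeumannAlgebra H) : Prop :=
  ∃ 𝓕 : Set (NonUnitalStarSubalgebra ℂ (H →L[ℂ] H)),
    𝓕.Nonempty ∧ DirectedOn (· ≤ ·) 𝓕 ∧ (∀ 𝓐 ∈ 𝓕, FiniteDimensional ℂ 𝓐) ∧
      closure (ContinuousLinearMapWOT.ofCLM '' (⋃ 𝓐 ∈ 𝓕, (𝓐 : Set (H →L[ℂ] H))) :
        Set (H →WOT[ℂ] H)) = ContinuousLinearMapWOT.ofCLM '' (R : Set (H →L[ℂ] H))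

/-- The state space of a `C*`-algebra `𝓑` of operators: the positive linear functionals of norm
one, with the weak* topology (as a subspace of the weak dual). -/
def stateSpace (𝓑 : NonUnitalStarSubalgebra ℂ (H →L[ℂ] H)) : Set (WeakDual ℂ 𝓑) :=
  {ω | (∀ b : 𝓑, 0 ≤ ω (star b * b)) ∧ ‖WeakDual.toStrongDual ω‖ = 1}

/-- The restriction to `𝓑` of the vector functional `ω_x(A) = ⟨x, A x⟩`. -/
def vectorFunctional (𝓑 : NonUnitalStarSubalgebra ℂ (H →L[ℂ] H)) (x : H) (b : 𝓑) : ℂ :=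
  ⟪x, (b : H →L[ℂ] H) x⟫_ℂ

/-- The functional `ρ` is the barycenter `μ(K)⁻¹ ∫ ω dμ(ω)` of the nonzero measure `μ` on the state
space `K` (the integral is taken in the weak sense). -/
def IsBarycenter {𝓑 : NonUnitalStarSubalgebra ℂ (H →L[ℂ] H)} [MeasurableSpace (stateSpace 𝓑)]
    (μ : Measure (stateSpace 𝓑)) (ρ : 𝓑 → ℂ) : Prop :=
  μ ≠ 0 ∧ ∀ b : 𝓑, ρ b = ((μ.real Set.univ : ℝ) : ℂ)⁻¹ * ∫ ω, (ω : WeakDual ℂ 𝓑) b ∂μ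

variable (H) in
/-- A completely positive instrument on `B(H)` with value space `X`. Only its values on measurable
sets are meaningful. -/
structure CPInstrument (X : Type*) [MeasurableSpace X] where
  /-- The operation `𝓔[S]`, a completely positive linear map. -/
  op : Set X → ((H →L[ℂ] H) →CP (H →L[ℂ] H))
  /-- For fixed `T`, the map `S ↦ 𝓔[S](T)` is `σ`-additive in the weak-operator topology. -/
  hasSum_iUnion : ∀ (T : H →L[ℂ] H) (S : ℕ → Set X), (∀ i, MeasurableSet (S i)) →
    Pairwise (Function.onFun Disjoint S) →
      ∀ y z : H, HasSum (fun i => ⟪y, op (S i) T z⟫_ℂ) ⟪y, op (⋃ i, S i) T z⟫_ℂ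
  /-- `𝓔[S](I) ≤ I`. -/
  op_one_le : ∀ S, MeasurableSet S → op S 1 ≤ 1

/-- The instrument `𝓔` is local to the algebra `𝓐` if `𝓔[S](T) = 𝓔[S](I) T` for all `T ∈ 𝓐'` and
all measurable `S`. -/
def CPInstrument.IsLocalTo {X : Type*} [MeasurableSpace X] (𝓔 : CPInstrument H X)
    (𝓐 : VonNeumannAlgebra H) : Prop :=
  ∀ T ∈ 𝓐.commutant, ∀ S, MeasurableSet S → 𝓔.op S T = 𝓔.op S 1 * T

end HJW

end

noncomputable section

namespace HJW

variable {H : Type*} [NormedAddCommGroup H] [InnerProductSpace ℂ H] [CompleteSpace H]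

/-! Each Borel set `S` gives a positive form `(c, b) ↦ ∫_S ω(c* b) dμ` on `𝓑`. The barycenter
condition and `μ(K) ≤ 1` bound its diagonal by `‖b x‖²`, so it is represented by an effect `F S`
supported on the closure of `𝓑 x` (a Radon–Nikodym theorem for vector states). The form is balanced
under left multiplication, so `F S` lies in `𝓑'`; uniqueness of the representing operator turns
additivity of the integral into additivity of `F` (`exists_effects`).

Hyperfiniteness of `𝓑'` gives a completely positive projection `P` of `B(H)` onto `𝓑''`: average
over the compact unitary groups of the finite-dimensional algebras and take a weak limit along an
ultrafilter (`IsHyperfinite.exists_expectation`).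

The instrument is `𝓔[S](T) = F(S) P(T)`. The two factors commute, so this equals `F(S)^{1/2} P(T)
F(S)^{1/2}` and is completely positive. It is local because `P` fixes `𝓑''`, and it has the required
integrals because `𝓑 ⊆ 𝓑''`. Only `F` has to be σ-additive, so `P` need not be normal. -/

/-- A continuous operator with nonnegative quadratic form is nonnegative. -/
theorem nonneg_of_forall_inner_nonneg {E : Type*} [NormedAddCommGroup E] [InnerProductSpace ℂ E]
    {A : E →L[ℂ] E} (hA : ∀ v, 0 ≤ ⟪v, A v⟫_ℂ) : 0 ≤ A := by
  rw [ContinuousLinearMap.nonneg_iff_isPositive, ContinuousLinearMap.isPositive_iff_complex]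
  intro v
  have h : 0 ≤ ⟪A v, v⟫_ℂ := by
    rw [← inner_conj_symm]
    exact star_nonneg_iff.2 (hA v)
  obtain ⟨h1, h2⟩ := Complex.nonneg_iff.1 h
  exact ⟨Complex.ext rfl (by simpa using h2), h1⟩

theorem exists_eq_star_mul_self {A : Type*} [NonUnitalCStarAlgebra A] [PartialOrder A]
    [StarOrderedRing A] {a : A} (ha : 0 ≤ a) : ∃ b, a = star b * b :=
  CStarAlgebra.nonneg_iff_eq_star_mul_self.1 ha

/-! ### Complete positivity through kernels of positive type -/

section CompletePositivity

variable {n : Type*} [Fintype n]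

theorem proj_comp_adjoint_proj [DecidableEq n] (i j : n) :
    (PiLp.proj 2 (fun _ : n => H) i : PiLp 2 (fun _ : n => H) →L[ℂ] H) ∘L
      ContinuousLinearMap.adjoint (PiLp.proj 2 (fun _ : n => H) j) = if i = j then 1 else 0 := by
  have key : ∀ y : H, ContinuousLinearMap.adjoint
      (PiLp.proj 2 (fun _ : n => H) j : PiLp 2 (fun _ : n => H) →L[ℂ] H) y =
        WithLp.toLp 2 (Pi.single j y) := by
    intro y
    refine ext_inner_right ℂ fun w => ?_
    rw [ContinuousLinearMap.adjoint_inner_left, PiLp.inner_apply,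
      Finset.sum_eq_single j (fun k _ hk => by simp [hk]) (by simp)]
    simp
  ext y
  rw [ContinuousLinearMap.comp_apply, key]
  by_cases h : i = j
  · subst h; simp
  · simp [h]

theorem sum_adjoint_proj_comp_proj :
    ∑ k, ContinuousLinearMap.adjoint
        (PiLp.proj 2 (fun _ : n => H) k : PiLp 2 (fun _ : n => H) →L[ℂ] H) ∘L
      (PiLp.proj 2 (fun _ : n => H) k : PiLp 2 (fun _ : n => H) →L[ℂ] H) = 1 := by
  refine ContinuousLinearMap.ext fun v => ext_inner_right ℂ fun w => ?_
  simp [sum_inner, ContinuousLinearMap.adjoint_inner_left,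
    PiLp.inner_apply]

/-- A matrix of operators on `H` is nonnegative as soon as its quadratic form on `Hⁿ` is. -/
theorem cstarMatrix_nonneg_of_forall_sum_inner_nonneg (M : CStarMatrix n n (H →L[ℂ] H))
    (hM : ∀ v : n → H, 0 ≤ ∑ i, ∑ j, ⟪v i, M i j (v j)⟫_ℂ) : 0 ≤ M := by
  classical
  let p : n → PiLp 2 (fun _ : n => H) →L[ℂ] H := fun i => PiLp.proj 2 (fun _ : n => H) i
  let A : PiLp 2 (fun _ : n => H) →L[ℂ] PiLp 2 (fun _ : n => H) :=
    ∑ i, ∑ j, (p i).adjoint ∘L M i j ∘L p j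
  have hpp : ∀ i j, p i ∘L (p j).adjoint = if i = j then 1 else 0 := proj_comp_adjoint_proj
  have hA : 0 ≤ A := by
    refine nonneg_of_forall_inner_nonneg fun v => ?_
    have := hM v
    simpa [A, p, inner_sum, ContinuousLinearMap.adjoint_inner_right] using this
  -- The matrix acts on `Hⁿ` as the positive operator `A`; the blocks of a factor `S` with `A = S*
  -- S` form a matrix `N` with `M = N* N`.
  obtain ⟨S, hS⟩ := exists_eq_star_mul_self hA
  let N : CStarMatrix n n (H →L[ℂ] H) :=
    CStarMatrix.ofMatrix fun i j => p i ∘L S ∘L (p j).adjoint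
  have hMN : M = star N * N := by
    have hAM : ∀ i j, p i ∘L A ∘L (p j).adjoint = M i j := by
      intro i j
      have : p i ∘L A ∘L (p j).adjoint =
          ∑ k, ∑ l, (p i ∘L (p k).adjoint) ∘L M k l ∘L (p l ∘L (p j).adjoint) := by
        ext y
        simp [A, map_sum]
      rw [this]
      simp only [hpp]
      rw [Finset.sum_eq_single i (fun k _ hk => by simp [hk.symm]) (by simp),
        Finset.sum_eq_single j (fun k _ hk => by simp [hk]) (by simp)]
      ext y
      simp
    refine CStarMatrix.ext fun i j => ?_
    rw [← hAM, hS, CStarMatrix.mul_apply]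
    have h1 : p i ∘L (star S * S) ∘L (p j).adjoint = p i ∘L star S ∘L
        (∑ k, (p k).adjoint ∘L p k) ∘L S ∘L (p j).adjoint := by
      rw [sum_adjoint_proj_comp_proj]
      rfl
    rw [h1]
    ext y
    have hN : ∀ k l, N k l = p k ∘L S ∘L (p l).adjoint := fun _ _ => rfl
    simp [hN, CStarMatrix.star_apply, ContinuousLinearMap.star_eq_adjoint,
      ContinuousLinearMap.adjoint_comp, map_sum]
  rw [hMN]
  exact star_mul_self_nonneg N

/-- A map `Φ` on `B(H)` whose kernel `(S, T) ↦ Φ(S* T)` is of positive type. -/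
def IsPositiveType (Φ : (H →L[ℂ] H) → (H →L[ℂ] H)) : Prop :=
  ∀ (k : ℕ) (T : Fin k → (H →L[ℂ] H)) (v : Fin k → H),
    0 ≤ ∑ i, ∑ j, ⟪v i, Φ (star (T i) * T j) (v j)⟫_ℂ

theorem IsPositiveType.conj {Φ : (H →L[ℂ] H) → (H →L[ℂ] H)} (hΦ : IsPositiveType Φ)
    (A : H →L[ℂ] H) : IsPositiveType fun T => star A * Φ T * A := by
  intro k T v
  simpa [ContinuousLinearMap.star_eq_adjoint, ContinuousLinearMap.adjoint_inner_right]
    using hΦ k T fun i => A (v i)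

/-- A linear map of positive type is completely positive. -/
def IsPositiveType.toCompletelyPositiveMap {Φ : (H →L[ℂ] H) →ₗ[ℂ] (H →L[ℂ] H)}
    (hΦ : IsPositiveType Φ) : (H →L[ℂ] H) →CP (H →L[ℂ] H) where
  toLinearMap := Φ
  map_cstarMatrix_nonneg' k M hM := by
    obtain ⟨N, rfl⟩ := exists_eq_star_mul_self hM
    refine cstarMatrix_nonneg_of_forall_sum_inner_nonneg _ fun v => ?_
    -- Each row `l` of `N` contributes the entries `N l i* N l j`, so the quadratic form is a sum
    -- over rows of positive-type sums.
    have : ∑ i, ∑ j, ⟪v i, ((star N * N).map Φ) i j (v j)⟫_ℂ =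
        ∑ l, ∑ i, ∑ j, ⟪v i, Φ (star (N l i) * N l j) (v j)⟫_ℂ := by
      rw [Finset.sum_comm]
      conv_rhs => rw [Finset.sum_comm]
      rw [Finset.sum_comm]
      refine Finset.sum_congr rfl fun i _ => ?_
      conv_rhs => rw [Finset.sum_comm]
      refine Finset.sum_congr rfl fun j _ => ?_
      simp [CStarMatrix.mul_apply, CStarMatrix.star_apply]
    rw [this]
    exact Finset.sum_nonneg fun l _ => hΦ k (N l) v

end CompletePositivity

/-! ### Averaging, and the projection onto the commutant of a hyperfinite algebra -/

section Expectation

open Filter Topology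

theorem isCompact_unitary {A : Type*} [CStarAlgebra A] [FiniteDimensional ℂ A] :
    IsCompact (unitary A : Set A) := by
  have : ProperSpace A := FiniteDimensional.proper ℂ A
  refine Metric.isCompact_of_isClosed_isBounded isClosed_unitary ?_
  refine (Metric.isBounded_closedBall (x := (0 : A)) (r := 1)).subset fun u hu => ?_
  nontriviality A
  simpa using (CStarRing.norm_of_mem_unitary hu).le

theorem inner_integral_apply {X : Type*} [MeasurableSpace X] {ν : Measure X}
    {F : X → (H →L[ℂ] H)} (hF : Integrable F ν) (v w : H) :
    ⟪v, (∫ u, F u ∂ν) w⟫_ℂ = ∫ u, ⟪v, F u w⟫_ℂ ∂ν :=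
  (ContinuousLinearMap.integral_comp_comm
    ((innerSL ℂ v).comp (ContinuousLinearMap.apply ℂ H w)) hF).symm

theorem integrable_inner_apply {X : Type*} [MeasurableSpace X] {ν : Measure X}
    {F : X → (H →L[ℂ] H)} (hF : Integrable F ν) (v w : H) :
    Integrable (fun u => ⟪v, F u w⟫_ℂ) ν :=
  ((innerSL ℂ v).comp (ContinuousLinearMap.apply ℂ H w)).integrable_comp hF

/-- Averaging over the unitary group of a finite-dimensional unital `*`-algebra `V` of operators
projects `B(H)` onto the commutant of `V`. -/
theorem exists_average (V : StarSubalgebra ℂ (H →L[ℂ] H)) [FiniteDimensional ℂ V] :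
    ∃ P : (H →L[ℂ] H) →ₗ[ℂ] (H →L[ℂ] H), IsPositiveType P ∧ (∀ T, ‖P T‖ ≤ ‖T‖) ∧
      (∀ T, ∀ a ∈ V, a * P T = P T * a) ∧ ∀ T, (∀ a ∈ V, a * T = T * a) → P T = T := by
  have hcl : IsClosed (V : Set (H →L[ℂ] H)) :=
    Submodule.closed_of_finiteDimensional (Subalgebra.toSubmodule V.toSubalgebra)
  let _ : CStarAlgebra V := StarSubalgebra.cstarAlgebra V (h_closed := hcl)
  have : CompactSpace (unitary V) := isCompact_iff_compactSpace.1 isCompact_unitary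
  let _ : MeasurableSpace (unitary V) := borel _
  have : BorelSpace (unitary V) := ⟨rfl⟩
  let ν : Measure (unitary V) := Measure.haarMeasure ⊤
  have : IsProbabilityMeasure ν := ⟨Measure.haarMeasure_self⟩
  let c : unitary V → (H →L[ℂ] H) := fun u => ((u : V) : H →L[ℂ] H)
  have hc : Continuous c := continuous_subtype_val.comp continuous_subtype_val
  have hcont : ∀ T : H →L[ℂ] H, Continuous fun u => c u * T * star (c u) := fun T =>
    (hc.mul continuous_const).mul hc.star
  have hInt : ∀ T : H →L[ℂ] H, Integrable (fun u => c u * T * star (c u)) ν := fun T =>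
    (hcont T).integrable_of_hasCompactSupport (HasCompactSupport.of_compactSpace _)
  have hcu : ∀ u, star (c u) * c u = 1 := fun u =>
    congrArg Subtype.val (Unitary.star_mul_self_of_mem u.2)
  have hcu' : ∀ u, c u * star (c u) = 1 := fun u =>
    congrArg Subtype.val (Unitary.mul_star_self_of_mem u.2)
  have hcV : ∀ u, c u ∈ V := fun u => (u : V).2
  have hnorm : ∀ u (T : H →L[ℂ] H), ‖c u * T * star (c u)‖ ≤ ‖T‖ := by
    intro u T
    have h1 : ‖c u‖ ≤ 1 := by
      nontriviality (H →L[ℂ] H)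
      exact (CStarRing.norm_of_mem_unitary (Unitary.mem_iff.2 ⟨hcu u, hcu' u⟩)).le
    calc ‖c u * T * star (c u)‖ ≤ ‖c u‖ * ‖T‖ * ‖star (c u)‖ :=
          (norm_mul_le _ _).trans (by gcongr; exact norm_mul_le _ _)
      _ ≤ 1 * ‖T‖ * 1 := by rw [norm_star]; gcongr
      _ = ‖T‖ := by ring
  let P : (H →L[ℂ] H) →ₗ[ℂ] (H →L[ℂ] H) :=
    { toFun := fun T => ∫ u, c u * T * star (c u) ∂ν
      map_add' := fun S T => by
        rw [← integral_add (hInt S) (hInt T)]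
        simp only [mul_add, add_mul]
      map_smul' := fun r T => by
        rw [← integral_smul]
        simp }
  have hP : ∀ T, P T = ∫ u, c u * T * star (c u) ∂ν := fun _ => rfl
  refine ⟨P, ?_, ?_, ?_, ?_⟩
  · intro k T v
    -- Under the integral the double sum collapses to the square of a norm.
    have h1 : ∑ i, ∑ j, ⟪v i, P (star (T i) * T j) (v j)⟫_ℂ =
        ∫ u, ((‖∑ j, T j (star (c u) (v j))‖ ^ 2 : ℝ) : ℂ) ∂ν := by
      simp only [hP, inner_integral_apply (hInt _)]
      simp_rw [← integral_finsetSum Finset.univ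
        (fun j _ => integrable_inner_apply (hInt (star (T _) * T j)) (v _) (v j))]
      rw [← integral_finsetSum]
      · refine integral_congr_ae (Eventually.of_forall fun u => ?_)
        simp only [Complex.ofReal_pow]
        have hsq := inner_self_eq_norm_sq_to_K (𝕜 := ℂ) (∑ j, T j (star (c u) (v j)))
        rw [sum_inner] at hsq
        refine Eq.trans ?_ hsq
        refine Finset.sum_congr rfl fun i _ => ?_
        rw [inner_sum]
        refine Finset.sum_congr rfl fun j _ => ?_
        simp [ContinuousLinearMap.star_eq_adjoint, ← ContinuousLinearMap.adjoint_inner_right]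
      · intro i _
        exact integrable_finsetSum _ fun j _ => integrable_inner_apply (hInt _) _ _
    rw [h1, integral_complex_ofReal]
    exact_mod_cast integral_nonneg fun u => by positivity
  · intro T
    rw [hP]
    refine (norm_integral_le_of_norm_le_const (Eventually.of_forall fun u => hnorm u T)).trans ?_
    simp
  · intro T a ha
    -- Left invariance of Haar measure. Commutation with all of `V` follows because unitaries span a
    -- unital C*-algebra.
    have hinv : ∀ w, c w * P T * star (c w) = P T := by
      intro w
      have h1 : c w * P T * star (c w) =
          ∫ u, c w * (c u * T * star (c u)) * star (c w) ∂ν := by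
        rw [hP, integral_mul_const_of_integrable ((hInt T).const_mul _),
          integral_const_mul_of_integrable (hInt T)]
      have h2 : ∀ u, c w * (c u * T * star (c u)) * star (c w) =
          c (w * u) * T * star (c (w * u)) := by
        intro u
        have : c (w * u) = c w * c u := rfl
        rw [this, star_mul]
        simp only [mul_assoc]
      rw [h1]
      simp only [h2]
      exact integral_mul_left_eq_self (fun u => c u * T * star (c u)) w
    have hcomm : ∀ w, c w * P T = P T * c w := by
      intro w
      conv_rhs => rw [← hinv w]
      rw [mul_assoc (c w * P T), hcu, mul_one]
    have hspan : (⟨a, ha⟩ : V) ∈ Submodule.span ℂ (unitary V : Set V) := by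
      rw [CStarAlgebra.span_unitary]
      trivial
    suffices ∀ b ∈ Submodule.span ℂ (unitary V : Set V), (b : H →L[ℂ] H) * P T = P T * b from
      this _ hspan
    intro b hb
    induction hb using Submodule.span_induction with
    | mem u hu => exact hcomm ⟨u, hu⟩
    | zero => simp
    | add b b' _ _ h h' => simp [add_mul, mul_add, h, h']
    | smul r b _ h => simp [h]
  · intro T hT
    have : ∀ u, c u * T * star (c u) = T := fun u => by
      rw [hT _ (hcV u), mul_assoc, hcu', mul_one]
    rw [hP]
    simp [this]

/-- Adjoining the scalars keeps the algebra finite-dimensional and does not change its commutant. -/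
theorem exists_average_of_nonUnital (𝓐 : NonUnitalStarSubalgebra ℂ (H →L[ℂ] H))
    [hfin : FiniteDimensional ℂ 𝓐] :
    ∃ P : (H →L[ℂ] H) →ₗ[ℂ] (H →L[ℂ] H), IsPositiveType P ∧ (∀ T, ‖P T‖ ≤ ‖T‖) ∧
      (∀ T, ∀ a ∈ 𝓐, a * P T = P T * a) ∧ ∀ T, (∀ a ∈ 𝓐, a * T = T * a) → P T = T := by
  let V := (NonUnitalStarSubalgebra.unitization 𝓐).range
  have : FiniteDimensional ℂ 𝓐.toNonUnitalSubalgebra.toSubmodule := hfin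
  have : FiniteDimensional ℂ V := by
    refine Submodule.finiteDimensional_of_le (S₁ := Subalgebra.toSubmodule V.toSubalgebra)
      (S₂ := Submodule.span ℂ {1} ⊔ 𝓐.toNonUnitalSubalgebra.toSubmodule) ?_
    rintro _ ⟨a, rfl⟩
    refine Submodule.mem_sup.2 ⟨algebraMap ℂ _ a.fst, ?_, a.snd, a.snd.2,
      (NonUnitalStarSubalgebra.unitization_apply 𝓐 a).symm⟩
    rw [Algebra.algebraMap_eq_smul_one]
    exact Submodule.smul_mem _ _ (Submodule.mem_span_singleton_self _)
  obtain ⟨P, h1, h2, h3, h4⟩ := exists_average V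
  refine ⟨P, h1, h2, fun T a ha => h3 T a ⟨((⟨a, ha⟩ : 𝓐) : Unitization ℂ 𝓐), ?_⟩,
    fun T hT => h4 T ?_⟩
  · exact (NonUnitalStarSubalgebra.unitization_apply 𝓐 _).trans (by simp)
  · rintro _ ⟨a, rfl⟩
    have : NonUnitalStarSubalgebra.unitization 𝓐 a * T =
        T * NonUnitalStarSubalgebra.unitization 𝓐 a := by
      rw [NonUnitalStarSubalgebra.unitization_apply, add_mul, mul_add, hT _ a.snd.2,
        Algebra.commutes]
    exact this

/-- A bounded family of operators converges weakly along every ultrafilter. -/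
theorem exists_tendsto_inner_of_ultrafilter {ι : Type*} (U : Ultrafilter ι)
    (A : ι → (H →L[ℂ] H)) (C : ℝ) (hA : ∀ i, ‖A i‖ ≤ C) :
    ∃ L : H →L[ℂ] H, ∀ v w, Tendsto (fun i => ⟪A i v, w⟫_ℂ) U (𝓝 ⟪L v, w⟫_ℂ) := by
  have hbound : ∀ i v w, ‖⟪A i v, w⟫_ℂ‖ ≤ C * ‖v‖ * ‖w‖ := fun i v w =>
    (norm_inner_le_norm _ _).trans (by
      gcongr
      exact (A i).le_of_opNorm_le (hA i) v)
  have hex : ∀ v w, ∃ z, Tendsto (fun i => ⟪A i v, w⟫_ℂ) U (𝓝 z) := by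
    intro v w
    obtain ⟨z, -, hz⟩ := (isCompact_closedBall (0 : ℂ) (C * ‖v‖ * ‖w‖)).ultrafilter_le_nhds
      (U.map fun i => ⟪A i v, w⟫_ℂ) (by
        rw [le_principal_iff]
        exact Filter.mem_map.2 (Eventually.of_forall fun i => by simpa using hbound i v w))
    exact ⟨z, hz⟩
  choose g hg using hex
  -- The pointwise limits form a sesquilinear form bounded by `C`, which a bounded operator
  -- represents.
  let B₀ : H →ₗ⋆[ℂ] H →ₗ[ℂ] ℂ := LinearMap.mk₂'ₛₗ (starRingEnd ℂ) (RingHom.id ℂ) g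
    (fun v v' w => tendsto_nhds_unique (hg _ _) (by
      simpa [inner_add_left] using (hg v w).add (hg v' w)))
    (fun r v w => tendsto_nhds_unique (hg _ _) (by
      simpa [inner_smul_left, mul_comm] using (hg v w).const_mul ((starRingEnd ℂ) r)))
    (fun v w w' => tendsto_nhds_unique (hg _ _) (by
      simpa [inner_add_right] using (hg v w).add (hg v w')))
    (fun r v w => tendsto_nhds_unique (hg _ _) (by
      simpa [inner_smul_right] using (hg v w).const_mul r))
  let B : H →L⋆[ℂ] H →L[ℂ] ℂ := B₀.mkContinuous₂ C fun v w =>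
    le_of_tendsto (hg v w).norm (Eventually.of_forall fun i => hbound i v w)
  refine ⟨InnerProductSpace.continuousLinearMapOfBilin B, fun v w => ?_⟩
  rw [InnerProductSpace.continuousLinearMapOfBilin_apply]
  exact hg v w

/-- If `R` is hyperfinite, there is a completely positive projection of `B(H)` onto the commutant
of `R`. -/
theorem IsHyperfinite.exists_expectation {R : VonNeumannAlgebra H} (hR : IsHyperfinite R) :
    ∃ P : (H →L[ℂ] H) →ₗ[ℂ] (H →L[ℂ] H), IsPositiveType P ∧
      (∀ T, ∀ a ∈ R, a * P T = P T * a) ∧ ∀ T, (∀ a ∈ R, a * T = T * a) → P T = T := by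
  obtain ⟨𝓕, hne, hdir, hfin, hcl⟩ := hR
  have hsub : ∀ 𝓐 ∈ 𝓕, ∀ a ∈ 𝓐, a ∈ R := by
    intro 𝓐 h𝓐 a ha
    have : ContinuousLinearMapWOT.ofCLM a ∈
        ContinuousLinearMapWOT.ofCLM '' (R : Set (H →L[ℂ] H)) := by
      rw [← hcl]
      exact subset_closure ⟨a, Set.mem_biUnion h𝓐 ha, rfl⟩
    obtain ⟨b, hb, hab⟩ := this
    have : b = a := ContinuousLinearMapWOT.ofCLM_injective hab
    exact this ▸ hb
  have : Nonempty 𝓕 := hne.to_subtype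
  have : IsDirectedOrder 𝓕 := ⟨fun a b => by
    obtain ⟨c, hc, h1, h2⟩ := hdir a a.2 b b.2
    exact ⟨⟨c, hc⟩, h1, h2⟩⟩
  have hav := fun 𝓐 : 𝓕 =>
    have := hfin 𝓐 𝓐.2
    exists_average_of_nonUnital (𝓐 : NonUnitalStarSubalgebra ℂ (H →L[ℂ] H))
  choose Q hpos hnorm hcomm hfix using hav
  -- An ultrafilter finer than `atTop` makes all the bounded averages converge at once, and it
  -- contains every tail of the directed family.
  let U : Ultrafilter 𝓕 := Ultrafilter.of atTop
  have hU : (U : Filter 𝓕) ≤ atTop := Ultrafilter.of_le _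
  choose L hL using fun T =>
    exists_tendsto_inner_of_ultrafilter U (fun 𝓐 => Q 𝓐 T) ‖T‖ fun 𝓐 => hnorm 𝓐 T
  have hL' : ∀ T v w, Tendsto (fun 𝓐 => ⟪v, Q 𝓐 T w⟫_ℂ) U (𝓝 ⟪v, L T w⟫_ℂ) := by
    intro T v w
    simpa [Function.comp_def] using (Complex.continuous_conj.tendsto _).comp (hL T w v)
  let P : (H →L[ℂ] H) →ₗ[ℂ] (H →L[ℂ] H) :=
    { toFun := L
      map_add' := fun S T => ContinuousLinearMap.ext fun v => ext_inner_left ℂ fun w =>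
        tendsto_nhds_unique (hL' _ _ _) (by
          simpa [inner_add_right] using (hL' S w v).add (hL' T w v))
      map_smul' := fun r T => ContinuousLinearMap.ext fun v => ext_inner_left ℂ fun w =>
        tendsto_nhds_unique (hL' _ _ _) (by
          simpa [inner_smul_right] using (hL' T w v).const_mul r) }
  refine ⟨P, ?_, ?_, ?_⟩
  · intro k T v
    refine ge_of_tendsto (tendsto_finsetSum _ fun i _ => tendsto_finsetSum _ fun j _ =>
      hL' (star (T i) * T j) (v i) (v j)) (Eventually.of_forall fun 𝓐 => hpos 𝓐 k T v)
  · intro T a ha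
    have hmem : ContinuousLinearMapWOT.ofCLM a ∈
        closure (ContinuousLinearMapWOT.ofCLM '' (⋃ 𝓐 ∈ 𝓕, (𝓐 : Set (H →L[ℂ] H))) :
          Set (H →WOT[ℂ] H)) := by
      rw [hcl]
      exact ⟨a, ha, rfl⟩
    -- Commuting with the fixed operator `L T` is a weak-operator closed condition, so it is enough
    -- to check it on the union of the family. There, `b ∈ 𝓐` commutes with the averages over all
    -- larger algebras, hence with their limit.
    have hclosed : IsClosed {b : H →WOT[ℂ] H | b * ContinuousLinearMapWOT.ofCLM (L T) =
        ContinuousLinearMapWOT.ofCLM (L T) * b} :=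
      isClosed_eq (continuous_mul_const _) (continuous_const_mul _)
    have key := closure_minimal ?_ hclosed hmem
    · exact ContinuousLinearMapWOT.ofCLM_injective key
    · rintro _ ⟨b, hb, rfl⟩
      obtain ⟨𝓐, h𝓐, hb⟩ := Set.mem_iUnion₂.1 hb
      refine congrArg ContinuousLinearMapWOT.ofCLM (?_ : b * L T = L T * b)
      refine ContinuousLinearMap.ext fun v => ext_inner_left ℂ fun w => ?_
      have h1 : Tendsto (fun 𝓒 => ⟪w, b (Q 𝓒 T v)⟫_ℂ) U (𝓝 ⟪w, b (L T v)⟫_ℂ) := by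
        simpa [ContinuousLinearMap.adjoint_inner_left] using
          hL' T (ContinuousLinearMap.adjoint b w) v
      refine tendsto_nhds_unique h1 ((hL' T w (b v)).congr' ?_)
      filter_upwards [hU (eventually_ge_atTop ⟨𝓐, h𝓐⟩)] with 𝓒 h𝓒
      exact congrArg (fun A : H →L[ℂ] H => ⟪w, A v⟫_ℂ) (hcomm 𝓒 T b (h𝓒 hb)).symm
  · intro T hT
    refine ContinuousLinearMap.ext fun v => ext_inner_left ℂ fun w =>
      tendsto_nhds_unique (hL' _ _ _) ?_
    have : ∀ 𝓐, Q 𝓐 T = T := fun 𝓐 => hfix 𝓐 T fun a ha => hT a (hsub 𝓐 𝓐.2 a ha)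
    simp [this]

end Expectation

/-! ### Operators representing dominated sesquilinear forms -/

section DominatedForm

open Filter Topology

variable {E : Type*} [AddCommGroup E] [Module ℂ E]

/-- Polarization: the diagonal is real at `b + c` and at `b + i c`. -/
theorem sesquilinear_conj_symm_of_nonneg {q : E →ₗ⋆[ℂ] E →ₗ[ℂ] ℂ} (hq : ∀ b, 0 ≤ q b b) (b c : E) :
    (starRingEnd ℂ) (q c b) = q b c := by
  have him : ∀ b, (q b b).im = 0 := fun b => (Complex.nonneg_iff.1 (hq b)).2.symm
  have h1 := him (b + c)
  have h2 := him (b + Complex.I • c)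
  simp [him] at h1 h2
  refine Complex.ext ?_ ?_ <;> simp <;> linarith

theorem norm_sesquilinear_le_of_nonneg {q : E →ₗ⋆[ℂ] E →ₗ[ℂ] ℂ} (hq : ∀ b, 0 ≤ q b b)
    (b c : E) : ‖q b c‖ ^ 2 ≤ (q b b).re * (q c c).re := by
  let core : PreInnerProductSpace.Core ℂ E :=
    { inner := fun b c => q b c
      conj_inner_symm := sesquilinear_conj_symm_of_nonneg hq
      re_inner_nonneg := fun b => (Complex.nonneg_iff.1 (hq b)).1
      add_left := fun a b c => by simp
      smul_left := fun a b r => by simp }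
  have h := InnerProductSpace.Core.inner_mul_inner_self_le (c := core) b c
  have h1 : ‖q c b‖ = ‖q b c‖ := by
    rw [← sesquilinear_conj_symm_of_nonneg hq b c, RCLike.norm_conj]
  calc ‖q b c‖ ^ 2 = ‖q b c‖ * ‖q c b‖ := by rw [h1, sq]
    _ ≤ _ := h

/-- The closure of the range of a linear map into `H`. -/
abbrev closedRange (j : E →ₗ[ℂ] H) : Submodule ℂ H := (LinearMap.range j).topologicalClosure

/-- The operator `T` lives on the closure of the range of `j`, and represents the sesquilinear
form `q` there. -/
structure Represents (j : E →ₗ[ℂ] H) (q : E →ₗ⋆[ℂ] E →ₗ[ℂ] ℂ) (T : H →L[ℂ] H) : Prop where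
  compress : (closedRange j).starProjection * T * (closedRange j).starProjection = T
  inner_eq : ∀ c b, ⟪T (j c), j b⟫_ℂ = q c b

theorem inner_eq_inner_starProjection {V : Type*} [NormedAddCommGroup V] [InnerProductSpace ℂ V]
    {K : Submodule ℂ V} [K.HasOrthogonalProjection]
    {T : V →L[ℂ] V} (hT : K.starProjection * T * K.starProjection = T) (y z : V) :
    ⟪T y, z⟫_ℂ = ⟪T (K.starProjection y), K.starProjection z⟫_ℂ := by
  conv_lhs => rw [← hT]
  simp [Submodule.inner_starProjection_left_eq_right]

/-- Compression reduces the claim to vectors in the closed range, where density and continuity in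
each variable suffice. -/
theorem eq_of_forall_inner_eq {j : E →ₗ[ℂ] H} {T T' : H →L[ℂ] H}
    (hT : (closedRange j).starProjection * T * (closedRange j).starProjection = T)
    (hT' : (closedRange j).starProjection * T' * (closedRange j).starProjection = T')
    (h : ∀ c b, ⟪T (j c), j b⟫_ℂ = ⟪T' (j c), j b⟫_ℂ) : T = T' := by
  refine ContinuousLinearMap.ext fun y => ext_inner_right ℂ fun z => ?_
  rw [inner_eq_inner_starProjection hT, inner_eq_inner_starProjection hT']
  have key : ∀ y ∈ closedRange j, ∀ z ∈ closedRange j, ⟪T y, z⟫_ℂ = ⟪T' y, z⟫_ℂ := by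
    intro y hy z hz
    refine closure_minimal (s := (LinearMap.range j : Set H)) (t := {y | ⟪T y, z⟫_ℂ = ⟪T' y, z⟫_ℂ})
      ?_ (isClosed_eq (by fun_prop) (by fun_prop)) hy
    rintro _ ⟨c, rfl⟩
    refine closure_minimal (s := (LinearMap.range j : Set H))
      (t := {z | ⟪T (j c), z⟫_ℂ = ⟪T' (j c), z⟫_ℂ})
      ?_ (isClosed_eq (by fun_prop) (by fun_prop)) hz
    rintro _ ⟨b, rfl⟩
    exact h c b
  exact key _ (Submodule.starProjection_apply_mem _ _) _ (Submodule.starProjection_apply_mem _ _)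

/-- Cauchy–Schwarz and domination give `|q(c, b)| ≤ ‖j c‖ ‖j b‖`. Hence `q` descends through `j`,
even when `j` is not injective, and extends to a bounded form on the closed range, to which Riesz
representation applies. -/
theorem exists_represents {j : E →ₗ[ℂ] H} {q : E →ₗ⋆[ℂ] E →ₗ[ℂ] ℂ} (hq : ∀ b, 0 ≤ q b b)
    (hj : ∀ b, (q b b).re ≤ ‖j b‖ ^ 2) : ∃ T, Represents j q T := by
  have hbound : ∀ c b, ‖q c b‖ ≤ ‖j c‖ * ‖j b‖ := fun c b => by
    refine le_of_sq_le_sq ?_ (by positivity)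
    rw [mul_pow]
    refine (norm_sesquilinear_le_of_nonneg hq c b).trans ?_
    exact mul_le_mul (hj c) (hj b) (Complex.nonneg_iff.1 (hq b)).1 (by positivity)
  let K := closedRange j
  let e : E →ₗ[ℂ] K := j.codRestrict K fun b =>
    (LinearMap.range j).le_topologicalClosure (LinearMap.mem_range_self j b)
  have he : DenseRange e := by
    intro y
    rw [closure_subtype]
    have : ((↑) '' Set.range e : Set H) = LinearMap.range j := by
      rw [← Set.range_comp]
      rfl
    rw [this]
    exact y.2
  have hF : ∀ c, ∃ C, ∀ b, ‖q c b‖ ≤ C * ‖e b‖ := fun c => ⟨‖j c‖, fun b => hbound c b⟩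
  let F : E → StrongDual ℂ K := fun c => (q c).extendOfNorm e
  have hFe : ∀ c b, F c (e b) = q c b := fun c b => LinearMap.extendOfNorm_eq he (hF c) b
  let r₀ : E → K := fun c => (InnerProductSpace.toDual ℂ K).symm (F c)
  have hr₀ : ∀ c b, ⟪r₀ c, e b⟫_ℂ = q c b := fun c b => by
    rw [← hFe]; exact InnerProductSpace.toDual_symm_apply
  have hext : ∀ y z : K, (∀ b, ⟪y, e b⟫_ℂ = ⟪z, e b⟫_ℂ) → y = z := fun y z h =>
    ext_inner_right ℂ fun w => he.induction_on w
      (isClosed_eq (by fun_prop) (by fun_prop)) h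
  let r : E →ₗ[ℂ] K :=
    { toFun := r₀
      map_add' := fun c c' => hext _ _ fun b => by simp [hr₀]
      map_smul' := fun s c => hext _ _ fun b => by simp [hr₀, mul_comm] }
  -- The same estimate bounds the Riesz vector by `‖j c‖`, which permits the second extension, now
  -- in the variable `c`.
  have hr : ∃ C, ∀ c, ‖r c‖ ≤ C * ‖e c‖ := by
    refine ⟨1, fun c => ?_⟩
    rw [one_mul]
    change ‖(InnerProductSpace.toDual ℂ K).symm (F c)‖ ≤ _
    rw [LinearIsometryEquiv.norm_map]
    exact LinearMap.opNorm_extendOfNorm_le he (norm_nonneg _) fun b => hbound c b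
  let T₀ : K →L[ℂ] K := r.extendOfNorm e
  have hT₀ : ∀ c, T₀ (e c) = r c := LinearMap.extendOfNorm_eq he hr
  refine ⟨K.subtypeL ∘L T₀ ∘L K.orthogonalProjectionOnto, ⟨?_, fun c b => ?_⟩⟩
  · ext y
    have h : K.orthogonalProjectionOnto (K.starProjection y) = K.orthogonalProjectionOnto y :=
      Submodule.orthogonalProjectionOnto_mem_subspace_eq_self (K.orthogonalProjectionOnto y)
    simp [K] at h ⊢
    rw [h]
  · have h : K.orthogonalProjectionOnto (j c) = e c :=
      Submodule.orthogonalProjectionOnto_mem_subspace_eq_self (e c)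
    rw [ContinuousLinearMap.comp_apply, ContinuousLinearMap.comp_apply, h, hT₀]
    exact hr₀ c b

namespace Represents

variable {j : E →ₗ[ℂ] H} {q : E →ₗ⋆[ℂ] E →ₗ[ℂ] ℂ} {T : H →L[ℂ] H}

theorem unique {T' : H →L[ℂ] H} (hT : Represents j q T) (hT' : Represents j q T') : T = T' :=
  eq_of_forall_inner_eq hT.compress hT'.compress fun c b =>
    (hT.inner_eq c b).trans (hT'.inner_eq c b).symm

theorem add {q' : E →ₗ⋆[ℂ] E →ₗ[ℂ] ℂ} {T' : H →L[ℂ] H} (hT : Represents j q T)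
    (hT' : Represents j q' T') : Represents j (q + q') (T + T') where
  compress := by rw [mul_add, add_mul, hT.compress, hT'.compress]
  inner_eq c b := by simp [hT.inner_eq, hT'.inner_eq]

theorem zero : Represents j (0 : E →ₗ⋆[ℂ] E →ₗ[ℂ] ℂ) (0 : H →L[ℂ] H) where
  compress := by simp
  inner_eq c b := by simp

theorem sum {ι : Type*} (s : Finset ι) {q : ι → E →ₗ⋆[ℂ] E →ₗ[ℂ] ℂ} {T : ι → (H →L[ℂ] H)}
    (hT : ∀ i, Represents j (q i) (T i)) : Represents j (∑ i ∈ s, q i) (∑ i ∈ s, T i) := by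
  classical
  induction s using Finset.induction_on with
  | empty => simpa using zero
  | insert i s hi ih => simpa [hi] using (hT i).add ih

theorem nonneg (hT : Represents j q T) (hq : ∀ b, 0 ≤ q b b) : 0 ≤ T := by
  have key : ∀ y ∈ closedRange j, 0 ≤ ⟪T y, y⟫_ℂ := fun y hy => by
    refine closure_minimal (s := (LinearMap.range j : Set H)) (t := {y | 0 ≤ ⟪T y, y⟫_ℂ})
      ?_ (isClosed_le (by fun_prop) (by fun_prop)) hy
    rintro _ ⟨b, rfl⟩
    simpa [hT.inner_eq] using hq b
  refine nonneg_of_forall_inner_nonneg fun v => ?_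
  rw [← inner_conj_symm, inner_eq_inner_starProjection hT.compress]
  exact star_nonneg_iff.2 (key _ (Submodule.starProjection_apply_mem _ _))

/-- The bound extends from the closed range to `H` because the projection does not increase norms.
-/
theorem le_one (hT : Represents j q T) (hj : ∀ b, q b b ≤ ((‖j b‖ ^ 2 : ℝ) : ℂ)) :
    T ≤ 1 := by
  have key : ∀ y ∈ closedRange j, ⟪T y, y⟫_ℂ ≤ ((‖y‖ ^ 2 : ℝ) : ℂ) := fun y hy => by
    refine closure_minimal (s := (LinearMap.range j : Set H))
      (t := {y | ⟪T y, y⟫_ℂ ≤ ((‖y‖ ^ 2 : ℝ) : ℂ)})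
      ?_ (isClosed_le (by fun_prop) (by fun_prop)) hy
    rintro _ ⟨b, rfl⟩
    simpa [hT.inner_eq] using hj b
  rw [← sub_nonneg]
  refine nonneg_of_forall_inner_nonneg fun v => ?_
  have h1 : ⟪T v, v⟫_ℂ ≤ ⟪v, v⟫_ℂ := by
    rw [inner_eq_inner_starProjection hT.compress]
    refine (key _ (Submodule.starProjection_apply_mem _ _)).trans ?_
    refine le_of_le_of_eq ((Complex.real_le_real (y := ‖v‖ ^ 2)).2 ?_) ?_
    · gcongr
      exact Submodule.norm_starProjection_apply_le _ _
    · rw [Complex.ofReal_pow]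
      exact (inner_self_eq_norm_sq_to_K (𝕜 := ℂ) v).symm
  rw [← inner_conj_symm]
  refine star_nonneg_iff.2 ?_
  simpa [inner_sub_left] using h1

/-- An operator `d` that leaves the range of `j` invariant together with its adjoint, and for which
`q` is balanced, commutes with the operator that represents `q`. -/
theorem commute (hT : Represents j q T) (d : H →L[ℂ] H) (m m' : E → E)
    (hm : ∀ b, d (j b) = j (m b)) (hm' : ∀ b, star d (j b) = j (m' b))
    (hq : ∀ c b, q (m c) b = q c (m' b)) : d * T = T * d := by
  set p := (closedRange j).starProjection with hp
  have hstar : star p = p := isSelfAdjoint_starProjection (closedRange j)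
  have hinv : ∀ (a : H →L[ℂ] H) (f : E → E), (∀ b, a (j b) = j (f b)) → p * (a * p) = a * p := by
    intro a f hf
    ext y
    refine Submodule.starProjection_eq_self_iff.2 ?_
    have hmaps : Set.MapsTo a (closure (LinearMap.range j : Set H))
        (closure (LinearMap.range j : Set H)) := by
      refine Set.MapsTo.closure ?_ a.continuous
      rintro _ ⟨b, rfl⟩
      exact ⟨f b, (hf b).symm⟩
    exact hmaps (Submodule.starProjection_apply_mem (closedRange j) y)
  -- Invariance of the closed range under both `d` and its adjoint makes it reducing for `d`.
  have hdp : d * p = p * d := by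
    have h1 := hinv d m hm
    have h2 := congrArg star (hinv (star d) m' hm')
    simp only [star_mul, star_star, hstar] at h2
    rw [← h1, ← mul_assoc, h2]
  refine eq_of_forall_inner_eq (j := j) ?_ ?_ fun c b => ?_
  · rw [← hp, ← mul_assoc, ← hdp, mul_assoc d, mul_assoc d, hT.compress]
  · rw [← hp, mul_assoc, mul_assoc T, hdp, ← mul_assoc T, ← mul_assoc,
      ← mul_assoc p T, hT.compress]
  · have h1 : ⟪(d * T) (j c), j b⟫_ℂ = ⟪T (j c), star d (j b)⟫_ℂ := by
      simp [ContinuousLinearMap.star_eq_adjoint, ContinuousLinearMap.adjoint_inner_right]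
    have h2 : (T * d) (j c) = T (d (j c)) := rfl
    rw [h1, h2, hm, hm', hT.inner_eq, hT.inner_eq, hq]

end Represents

/-- Weak convergence of a bounded family of operators need only be checked on dense subsets. -/
theorem tendsto_inner_of_mem_closure {V : Type*} [NormedAddCommGroup V] [InnerProductSpace ℂ V]
    {ι : Type*} {l : Filter ι} {A : ι → (V →L[ℂ] V)}
    {B : V →L[ℂ] V} {C : ℝ} (hA : ∀ i, ‖A i‖ ≤ C) {D : Set V}
    (hD : ∀ y ∈ D, ∀ z ∈ D, Tendsto (fun i => ⟪A i y, z⟫_ℂ) l (𝓝 ⟪B y, z⟫_ℂ))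
    {y z : V} (hy : y ∈ closure D) (hz : z ∈ closure D) :
    Tendsto (fun i => ⟪A i y, z⟫_ℂ) l (𝓝 ⟪B y, z⟫_ℂ) := by
  have hA' : ∀ i, ‖A i‖ ≤ C.toNNReal := fun i => (hA i).trans (Real.le_coe_toNNReal C)
  -- The uniform norm bound makes the functions equi-Lipschitz, so the set where they converge to
  -- the given limit is closed.
  have hclosed₁ : ∀ z, IsClosed {y | Tendsto (fun i => ⟪A i y, z⟫_ℂ) l (𝓝 ⟪B y, z⟫_ℂ)} := by
    intro z
    refine Equicontinuous.isClosed_setOfPred_tendsto (F := fun i y => ⟪A i y, z⟫_ℂ)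
      (LipschitzWith.uniformEquicontinuous _ (C.toNNReal * ‖z‖₊) fun i =>
        LipschitzWith.of_dist_le_mul fun y y' => ?_).equicontinuous (by fun_prop)
    rw [dist_eq_norm, dist_eq_norm, ← inner_sub_left, ← map_sub]
    refine (norm_inner_le_norm _ _).trans ?_
    calc ‖A i (y - y')‖ * ‖z‖ ≤ (C.toNNReal * ‖y - y'‖) * ‖z‖ := by
          gcongr
          exact (A i).le_of_opNorm_le (hA' i) _
      _ = _ := by push_cast; ring
  have hclosed₂ : ∀ y, IsClosed {z | Tendsto (fun i => ⟪A i y, z⟫_ℂ) l (𝓝 ⟪B y, z⟫_ℂ)} := by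
    intro y
    refine Equicontinuous.isClosed_setOfPred_tendsto (F := fun i z => ⟪A i y, z⟫_ℂ)
      (LipschitzWith.uniformEquicontinuous _ (C.toNNReal * ‖y‖₊) fun i =>
        LipschitzWith.of_dist_le_mul fun z z' => ?_).equicontinuous (by fun_prop)
    rw [dist_eq_norm, dist_eq_norm, ← inner_sub_right]
    refine (norm_inner_le_norm _ _).trans ?_
    push_cast
    gcongr
    exact (A i).le_of_opNorm_le (hA' i) _
  exact closure_minimal (fun y hy => closure_minimal (fun z hz => hD y hy z hz) (hclosed₂ y) hz)
    (hclosed₁ z) hy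

end DominatedForm

/-- Positive elements span a C*-algebra. In the absence of a unit, this is how an identity for the
form `(c, b) ↦ ω(c* b)` passes to `ω(b)` for every `b`. -/
theorem span_range_star_mul_self {A : Type*} [NonUnitalCStarAlgebra A] :
    Submodule.span ℂ (Set.range fun a : A => star a * a) = ⊤ := by
  let _ : PartialOrder A := CStarAlgebra.spectralOrder A
  have : StarOrderedRing A := CStarAlgebra.spectralOrderedRing A
  rw [eq_top_iff, ← CStarAlgebra.span_nonneg]
  refine Submodule.span_mono fun a ha => ?_
  obtain ⟨b, rfl⟩ := exists_eq_star_mul_self (show 0 ≤ a from ha)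
  exact ⟨b, rfl⟩

/-! ### The positive operator valued measure in the commutant -/

section RadonNikodym

open Filter Topology

variable {𝓑 : NonUnitalStarSubalgebra ℂ (H →L[ℂ] H)}

theorem norm_state_apply_le (ω : stateSpace 𝓑) (b : 𝓑) : ‖(ω : WeakDual ℂ 𝓑) b‖ ≤ ‖b‖ := by
  have h := (WeakDual.toStrongDual (ω : WeakDual ℂ 𝓑)).le_opNorm b
  rw [ω.2.2, one_mul] at h
  exact h

variable [MeasurableSpace (stateSpace 𝓑)] [BorelSpace (stateSpace 𝓑)]

theorem integrable_state_apply (μ : Measure (stateSpace 𝓑)) [IsFiniteMeasure μ] (b : 𝓑) :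
    Integrable (fun ω : stateSpace 𝓑 => (ω : WeakDual ℂ 𝓑) b) μ :=
  Integrable.of_bound ((WeakDual.eval_continuous b).comp
    continuous_subtype_val).measurable.aestronglyMeasurable ‖b‖
    (Eventually.of_forall fun ω => norm_state_apply_le ω b)

/-- The sesquilinear form `(c, b) ↦ ∫ ω(c* b) dμ(ω)` on `𝓑`. -/
def integralForm (μ : Measure (stateSpace 𝓑)) [IsFiniteMeasure μ] : 𝓑 →ₗ⋆[ℂ] 𝓑 →ₗ[ℂ] ℂ :=
  LinearMap.mk₂'ₛₗ (starRingEnd ℂ) (RingHom.id ℂ)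
    (fun c b => ∫ ω : stateSpace 𝓑, (ω : WeakDual ℂ 𝓑) (star c * b) ∂μ)
    (fun c c' b => by
      rw [← integral_add (integrable_state_apply μ _) (integrable_state_apply μ _)]
      simp [add_mul])
    (fun r c b => by
      rw [← integral_smul]
      simp [smul_mul_assoc])
    (fun c b b' => by
      rw [← integral_add (integrable_state_apply μ _) (integrable_state_apply μ _)]
      simp [mul_add])
    (fun r c b => by
      rw [← integral_smul]
      simp [mul_smul_comm])

theorem integralForm_apply (μ : Measure (stateSpace 𝓑)) [IsFiniteMeasure μ] (c b : 𝓑) :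
    integralForm μ c b = ∫ ω : stateSpace 𝓑, (ω : WeakDual ℂ 𝓑) (star c * b) ∂μ := rfl

theorem integralForm_self (μ : Measure (stateSpace 𝓑)) [IsFiniteMeasure μ] (b : 𝓑) :
    integralForm μ b b =
      ((∫ ω : stateSpace 𝓑, ((ω : WeakDual ℂ 𝓑) (star b * b)).re ∂μ : ℝ) : ℂ) := by
  rw [integralForm_apply, ← integral_complex_ofReal]
  refine integral_congr_ae (Eventually.of_forall fun ω => ?_)
  exact Complex.ext rfl (by simpa using (Complex.nonneg_iff.1 (ω.2.1 b)).2.symm)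

theorem integralForm_self_nonneg (μ : Measure (stateSpace 𝓑)) [IsFiniteMeasure μ] (b : 𝓑) :
    0 ≤ integralForm μ b b := by
  rw [integralForm_self]
  exact_mod_cast integral_nonneg fun ω : stateSpace 𝓑 => (Complex.nonneg_iff.1 (ω.2.1 b)).1

theorem integralForm_self_mono {μ ν : Measure (stateSpace 𝓑)} [IsFiniteMeasure μ]
    [IsFiniteMeasure ν] (h : ν ≤ μ) (b : 𝓑) : integralForm ν b b ≤ integralForm μ b b := by
  rw [integralForm_self, integralForm_self, Complex.real_le_real]
  exact integral_mono_measure h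
    (Eventually.of_forall fun ω => (Complex.nonneg_iff.1 (ω.2.1 b)).1)
    (integrable_state_apply μ _).re

variable (𝓑) in
/-- The map `b ↦ b x`. -/
def orbitMap (x : H) : 𝓑 →ₗ[ℂ] H where
  toFun b := (b : H →L[ℂ] H) x
  map_add' _ _ := rfl
  map_smul' _ _ := rfl

/-- The barycenter identity at `b* b` makes the left side exactly `μ(K) ‖b x‖²`, and `μ(K) ≤ 1`. -/
theorem integralForm_self_le {μ : Measure (stateSpace 𝓑)} [IsFiniteMeasure μ]
    (hμ : μ Set.univ ≤ 1) {x : H} (hbar : IsBarycenter μ (vectorFunctional 𝓑 x)) (b : 𝓑) :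
    integralForm μ b b ≤ ((‖orbitMap 𝓑 x b‖ ^ 2 : ℝ) : ℂ) := by
  have h0 : μ.real Set.univ ≠ 0 := by
    rw [Measure.real, ENNReal.toReal_ne_zero]
    exact ⟨fun h => hbar.1 (Measure.measure_univ_eq_zero.1 h), measure_ne_top _ _⟩
  have h1 : μ.real Set.univ ≤ 1 := ENNReal.toReal_le_of_le_ofReal zero_le_one (by simpa using hμ)
  have h2 : vectorFunctional 𝓑 x (star b * b) = ((‖orbitMap 𝓑 x b‖ ^ 2 : ℝ) : ℂ) := by
    have := inner_self_eq_norm_sq_to_K (𝕜 := ℂ) (orbitMap 𝓑 x b)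
    rw [Complex.ofReal_pow]
    refine Eq.trans ?_ this
    simp [vectorFunctional, orbitMap, ContinuousLinearMap.star_eq_adjoint,
      ContinuousLinearMap.adjoint_inner_right]
  have h3 : integralForm μ b b = ((μ.real Set.univ * ‖orbitMap 𝓑 x b‖ ^ 2 : ℝ) : ℂ) := by
    rw [Complex.ofReal_mul, ← h2, hbar.2, integralForm_apply, ← mul_assoc,
      mul_inv_cancel₀ (Complex.ofReal_ne_zero.2 h0), one_mul]
  rw [h3, Complex.real_le_real]
  exact mul_le_of_le_one_left (by positivity) h1

/-- Every subset measure of a measure whose barycenter is a vector state is given by an effect in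
the commutant, and these effects form a positive operator valued measure. -/
theorem exists_effects (h𝓑 : IsClosed (𝓑 : Set (H →L[ℂ] H))) {μ : Measure (stateSpace 𝓑)}
    (hμ : μ Set.univ ≤ 1) {x : H} (hbar : IsBarycenter μ (vectorFunctional 𝓑 x)) :
    ∃ F : Set (stateSpace 𝓑) → (H →L[ℂ] H), (∀ S, 0 ≤ F S) ∧ (∀ S, F S ≤ 1) ∧
      (∀ S, F S ∈ commutant 𝓑) ∧
      (∀ S, ∀ b : 𝓑, ⟪x, F S ((b : H →L[ℂ] H) x)⟫_ℂ = ∫ ω in S, (ω : WeakDual ℂ 𝓑) b ∂μ) ∧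
      ∀ S : ℕ → Set (stateSpace 𝓑), (∀ i, MeasurableSet (S i)) →
        Pairwise (Function.onFun Disjoint S) →
          ∀ y z : H, HasSum (fun i => ⟪y, F (S i) z⟫_ℂ) ⟪y, F (⋃ i, S i) z⟫_ℂ := by
  have : IsFiniteMeasure μ := ⟨hμ.trans_lt ENNReal.one_lt_top⟩
  have hle : ∀ S : Set (stateSpace 𝓑), ∀ b,
      integralForm (μ.restrict S) b b ≤ ((‖orbitMap 𝓑 x b‖ ^ 2 : ℝ) : ℂ) := fun S b =>
    (integralForm_self_mono Measure.restrict_le_self b).trans (integralForm_self_le hμ hbar b)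
  choose F hF using fun S : Set (stateSpace 𝓑) =>
    exists_represents (j := orbitMap 𝓑 x) (integralForm_self_nonneg (μ.restrict S))
      (fun b => (Complex.le_def.1 (hle S b)).1)
  have hnonneg : ∀ S, 0 ≤ F S := fun S => (hF S).nonneg (integralForm_self_nonneg _)
  have hle_one : ∀ S, F S ≤ 1 := fun S => (hF S).le_one (hle S)
  have hcomm : ∀ S, ∀ d : 𝓑, (d : H →L[ℂ] H) * F S = F S * d := fun S d =>
    (hF S).commute d (fun b => d * b) (fun b => star d * b) (fun _ => rfl) (fun _ => rfl)
      fun c b => by simp [integralForm_apply, mul_assoc]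
  refine ⟨F, hnonneg, hle_one, fun S => mem_commutant_iff.2 fun B hB => hcomm S ⟨B, hB⟩, ?_, ?_⟩
  · intro S b
    have : IsClosed (𝓑 : Set (H →L[ℂ] H)) := h𝓑
    have hb : b ∈ Submodule.span ℂ (Set.range fun a : 𝓑 => star a * a) := by
      rw [span_range_star_mul_self]
      trivial
    -- The vector `x` need not lie in the closure of `𝓑 x`, so the form is used only through `⟪x, F
    -- a* a x⟫ = ⟪a x, F a x⟫`, where `F` is moved past `a*`.
    induction hb using Submodule.span_induction with
    | mem b hb =>
      obtain ⟨a, rfl⟩ := hb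
      rw [← integralForm_apply, ← (hF S).inner_eq]
      have h1 : F S (((star a * a : 𝓑) : H →L[ℂ] H) x) =
          (star (a : H →L[ℂ] H)) (F S (orbitMap 𝓑 x a)) :=
        (congrArg (fun A : H →L[ℂ] H => A (orbitMap 𝓑 x a)) (hcomm S (star a))).symm
      have hsym : ∀ y z, ⟪F S y, z⟫_ℂ = ⟪y, F S z⟫_ℂ :=
        ((ContinuousLinearMap.nonneg_iff_isPositive _).1 (hnonneg S)).isSymmetric
      rw [h1, hsym, ContinuousLinearMap.star_eq_adjoint, ContinuousLinearMap.adjoint_inner_right]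
      rfl
    | zero => simp
    | add b b' _ _ h h' =>
      have : ∫ ω in S, (ω : WeakDual ℂ 𝓑) (b + b') ∂μ =
          ∫ ω in S, (ω : WeakDual ℂ 𝓑) b ∂μ + ∫ ω in S, (ω : WeakDual ℂ 𝓑) b' ∂μ := by
        rw [← integral_add (integrable_state_apply _ _) (integrable_state_apply _ _)]
        simp
      rw [this, ← h, ← h']
      simp
    | smul r b _ h =>
      have : ∫ ω in S, (ω : WeakDual ℂ 𝓑) (r • b) ∂μ = r * ∫ ω in S, (ω : WeakDual ℂ 𝓑) b ∂μ := by
        rw [← smul_eq_mul, ← integral_smul]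
        simp
      rw [this, ← h]
      simp
  · intro S hS hdisj y z
    -- Both sides represent the same form. This bounds the partial sums by one in norm, so their
    -- weak convergence need only be tested on `𝓑 x`.
    have hsum : ∀ s : Finset ℕ, ∑ i ∈ s, F (S i) = F (⋃ i ∈ s, S i) := by
      intro s
      refine (Represents.sum s fun i => hF (S i)).unique ?_
      have : ∑ i ∈ s, integralForm (μ.restrict (S i)) =
          integralForm (μ.restrict (⋃ i ∈ s, S i)) := by
        refine LinearMap.ext₂ fun c b => ?_
        rw [integralForm_apply, integral_biUnion_finset s (fun i _ => hS i)
          (fun i _ k _ hik => hdisj hik) fun i _ => (integrable_state_apply μ _).integrableOn]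
        simp [integralForm_apply]
      rw [this]
      exact hF _
    have hsym : ∀ S y z, ⟪y, F S z⟫_ℂ = ⟪F S y, z⟫_ℂ := fun S y z =>
      (((ContinuousLinearMap.nonneg_iff_isPositive _).1 (hnonneg S)).isSymmetric y z).symm
    have hnorm : ∀ s : Finset ℕ, ‖∑ i ∈ s, F (S i)‖ ≤ 1 := by
      intro s
      rw [hsum]
      exact (CStarAlgebra.norm_le_one_iff_of_nonneg _ (hnonneg _)).2 (hle_one _)
    simp only [hsym]
    -- All the effects are compressed to the closure of `𝓑 x`, so `y` and `z` may be replaced by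
    -- their projections onto it.
    have hcompress := fun S => inner_eq_inner_starProjection (hF S).compress y z
    simp only [hcompress]
    have := tendsto_inner_of_mem_closure (l := atTop) (A := fun s : Finset ℕ => ∑ i ∈ s, F (S i))
      (B := F (⋃ i, S i)) hnorm (D := LinearMap.range (orbitMap 𝓑 x)) ?_
      (Submodule.starProjection_apply_mem (closedRange (orbitMap 𝓑 x)) y)
      (Submodule.starProjection_apply_mem (closedRange (orbitMap 𝓑 x)) z)
    · simpa [HasSum, sum_inner] using this
    · rintro _ ⟨c, rfl⟩ _ ⟨b, rfl⟩
      have := hasSum_integral_iUnion (μ := μ) hS hdisj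
        (integrable_state_apply μ (star c * b)).integrableOn
      simpa [HasSum, sum_inner, (hF _).inner_eq, integralForm_apply] using this

end RadonNikodym

end HJW

end

/-! ### The instrument -/

theorem mainTheorem1 {H : Type*} [NormedAddCommGroup H] [InnerProductSpace ℂ H] [CompleteSpace H]
    (𝓑 : NonUnitalStarSubalgebra ℂ (H →L[ℂ] H)) (h𝓑 : IsClosed (𝓑 : Set (H →L[ℂ] H)))
    (x : H) (hx : ‖x‖ = 1)
    [MeasurableSpace (HJW.stateSpace 𝓑)] [BorelSpace (HJW.stateSpace 𝓑)]
    (μ : Measure (HJW.stateSpace 𝓑)) [μ.Regular] (hμ : μ Set.univ ≤ 1)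
    (hbar : HJW.IsBarycenter μ (HJW.vectorFunctional 𝓑 x))
    (hhyp : HJW.IsHyperfinite (HJW.commutant 𝓑)) :
    ∃ 𝓔 : HJW.CPInstrument H (HJW.stateSpace 𝓑),
      𝓔.IsLocalTo (HJW.commutant 𝓑) ∧
      ∀ (S : Set (HJW.stateSpace 𝓑)), MeasurableSet S → ∀ b : 𝓑,
        ⟪x, 𝓔.op S (b : H →L[ℂ] H) x⟫_ℂ = ∫ ω in S, (ω : WeakDual ℂ 𝓑) b ∂μ := by
  obtain ⟨P, hpos, hcomm, hfix⟩ := hhyp.exists_expectation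
  obtain ⟨F, hF0, hF1, hFmem, hFint, hFsum⟩ := HJW.exists_effects h𝓑 hμ hbar
  let Φ : Set (HJW.stateSpace 𝓑) → (H →L[ℂ] H) →ₗ[ℂ] (H →L[ℂ] H) := fun S =>
    LinearMap.mulLeft ℂ (F S) ∘ₗ P
  have hΦ : ∀ S T, Φ S T = F S * P T := fun _ _ => rfl
  have hΦpos : ∀ S, HJW.IsPositiveType (Φ S) := by
    intro S
    have h1 := hpos.conj (CFC.sqrt (F S))
    have h2 : (fun T => star (CFC.sqrt (F S)) * P T * CFC.sqrt (F S)) = Φ S := by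
      funext T
      -- `F S` lies in `𝓑'` and `P T` commutes with `𝓑'`; functional calculus passes this to the
      -- square root.
      have hc : Commute (CFC.sqrt (F S)) (P T) :=
        Commute.cfcₙ_nnreal (hcomm T _ (hFmem S)) _
      rw [(CFC.sqrt_nonneg (F S)).isSelfAdjoint.star_eq, mul_assoc, ← hc.eq, ← mul_assoc,
        CFC.sqrt_mul_sqrt_self _ (hF0 S), hΦ]
    rwa [h2] at h1
  have hone : P 1 = 1 := hfix 1 fun a _ => by simp
  let 𝓔 : HJW.CPInstrument H (HJW.stateSpace 𝓑) :=
    { op := fun S => (hΦpos S).toCompletelyPositiveMap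
      -- For fixed `T` and `z`, `P T z` is a fixed vector, so weak σ-additivity of `F` is enough.
      hasSum_iUnion := fun T S hS hdisj y z => hFsum S hS hdisj y (P T z)
      op_one_le := fun S _ => by
        change F S * P 1 ≤ 1
        rw [hone, mul_one]
        exact hF1 S }
  have hop : ∀ S T, 𝓔.op S T = F S * P T := fun _ _ => rfl
  refine ⟨𝓔, fun T hT S _ => ?_, fun S _ b => ?_⟩
  · rw [hop, hop, hone, mul_one, hfix T (VonNeumannAlgebra.mem_commutant_iff.1 hT)]
  · rw [hop, hfix b fun a ha => (HJW.mem_commutant_iff.1 ha b b.2).symm]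
    exact hFint S b
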